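/- **Setting.** Let $n,k,d$ be integers with $1\le k\le n-1$ and $1\le d\le n-1$, and let $\alpha,\beta\in[0,\infty]$. A stationary helper selection scheme $D$ on a set of nodes assigns to each node $i$ a helper set $D_i$. For a finite sequence of successive single node failures, its *information flow graph* (IFG) is the following capacitated digraph. There is a source $s$, and there are storage nodes $x$, each a pair $(x_{\mathrm{in}},x_{\mathrm{out}})$: one initial copy of every node, and one newcomer for every failure. A storage node is active from its creation until its node fails (again). The edges are: $s\to x_{\mathrm{in}}$ of capacity $\infty$ for every initial copy $x$; $x_{\mathrm{in}}\to x_{\mathrm{out}}$ of capacity $\alpha$ for every $x$; if $y$ is the newcomer that replaces node $i$, then $x_{\mathrm{out}}\to y_{\mathrm{in}}$ of capacity $\beta$ for the copy $x$, active at that time, of each node in $D_i$; and, for every set $S$ of $k$ nodes, a data collector $t_S$ with edges $x_{\mathrm{out}}\to t_S$ of capacity $\infty$ from the finally active copies $x$ of the nodes in $S$. Let $\mathcal G_D(k,\alpha,\beta)$ be the set of all IFGs of $D$ (over all finite failure sequences), $\mathrm{DC}(G)$ the set of data collectors of $G$, and $\operatorname{mincut}_G(s,t)$ the minimum capacity of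 a cut separating $s$ from $t$. *Family helper selection (FHS) scheme* on nodes $1,\dots,m$, for $d<m$: consecutive blocks of $m-d$ nodes form the $\lfloor m/(m-d)\rfloor$ complete families, and the remaining $m \bmod (m-d)$ nodes form the incomplete family. A node of a complete family has all the nodes outside its family as helpers; a node of the incomplete family has $1,\dots,d$ as helpers. Write $\mathcal G_F(m,k',d,\alpha,\beta)$ for its set of IFGs with data collectors accessing $k'$ nodes, $0\le k'\le m$. *Family-plus scheme* $F^+$: the $n$ nodes are partitioned into $B=\max(1,\lfloor n/(2d)\rfloor)$ groups, with $n_b=2d$ for $b<B$ and $n_B=n-2d(B-1)$; each group is sorted arbitrarily and the FHS scheme with parameter $d$ is applied inside each group. Let $\mathcal G_{F^+}(n,k,d,\alpha,\beta)$ be its set of IFGs. **Proposition.** All minima below are attained, and $$\min_{G\in\mathcal G_{F^+}(n,k,d,\alpha,\beta)}\ \min_{t\in \mathrm{DC}(G)}\operatorname{mincut}_G(s,t)=\min_{(k_1,\dots,k_B)\in K}\ \sum_{b=1}^{B}\ \min_{H_b\in\mathcal G_F(n_b,k_b,d,\alpha,\beta)}\ \min_{t_b\in \mathrm{DC}(H_b)}\operatorname{mincut}_{H_b}(s,t_b),$$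 where $K=\{(k_1,\dots,k_B)\in\mathbb Z^B: 0\le k_b\le n_b \text{ for all } b,\ \sum_{b=1}^B k_b=k\}$. The same holds for the generalized family-plus scheme, in which the $n$ nodes are partitioned into any number $B$ of groups of arbitrary sizes $n_b>d$. -/

import Mathlib

open scoped ENNReal

/-- The value of a cut `(U, Uᶜ)` of a finite capacitated digraph: the total capacity of the edges
that leave `U`.  A digraph is given by its capacities, `0` meaning "no edge". -/
noncomputable def cutValue {V : Type*} [Fintype V] (cap : V → V → ℝ≥0∞) (U : Set V) : ℝ≥0∞ :=
  open Classical in ∑ u : V, ∑ v : V, if u ∈ U ∧ v ∉ U then cap u v else 0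

/-- The minimum cut value separating `s` from `t`. -/
noncomputable def minCut {V : Type*} [Fintype V] (cap : V → V → ℝ≥0∞) (s t : V) : ℝ≥0∞ :=
  ⨅ U : {U : Set V // s ∈ U ∧ t ∉ U}, cutValue cap U.1

/-- A stationary helper selection scheme on a set `N` of physical nodes: whenever `i` fails, the
newcomer that replaces `i` contacts the nodes of `D i`. -/
abbrev HelperScheme (N : Type*) := N → Finset N

/-- Storage nodes of an information flow graph with `τ` failures: the initial copy of each
physical node, and one newcomer for every failure time. -/
abbrev StorageNode (N : Type*) (τ : ℕ) := N ⊕ Fin τ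

/-- Vertices of an information flow graph: the source, the input and output of every storage node,
and a data collector for every choice of `k` physical nodes. -/
inductive IFGVertex (N : Type*) (τ k : ℕ)
  | source : IFGVertex N τ k
  | inp (x : StorageNode N τ) : IFGVertex N τ k
  | out (x : StorageNode N τ) : IFGVertex N τ k
  | collector (S : {S : Finset N // S.card = k}) : IFGVertex N τ k

/-- The vertices as a sum type (used only for finiteness). -/
def IFGVertex.equivSum (N : Type*) (τ k : ℕ) :
    IFGVertex N τ k ≃
      Unit ⊕ StorageNode N τ ⊕ StorageNode N τ ⊕ {S : Finset N // S.card = k} where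
  toFun
    | .source => .inl ()
    | .inp x => .inr (.inl x)
    | .out x => .inr (.inr (.inl x))
    | .collector S => .inr (.inr (.inr S))
  invFun
    | .inl _ => .source
    | .inr (.inl x) => .inp x
    | .inr (.inr (.inl x)) => .out x
    | .inr (.inr (.inr S)) => .collector S
  left_inv v := by cases v <;> rfl
  right_inv v := by rcases v with _ | _ | _ | _ <;> rfl

instance {N : Type*} [Fintype N] {τ k : ℕ} : Fintype (IFGVertex N τ k) :=
  Fintype.ofEquiv _ (IFGVertex.equivSum N τ k).symm

/-- The physical node that a storage node realises; `h l` is the node that fails at time `l`. -/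
def StorageNode.label {N : Type*} {τ : ℕ} (h : Fin τ → N) : StorageNode N τ → N
  | .inl i => i
  | .inr j => h j

/-- `x` is active after the failures at times `0, …, l - 1` have been repaired: it exists by then,
and its physical node has not failed since it was created. -/
def StorageNode.IsActive {N : Type*} {τ : ℕ} (h : Fin τ → N) (l : ℕ) : StorageNode N τ → Prop
  | .inl i => ∀ j : Fin τ, j.val < l → h j ≠ i
  | .inr j₀ => j₀.val < l ∧ ∀ j : Fin τ, j₀ < j → j.val < l → h j ≠ h j₀

/-- The information flow graph of scheme `D` with failure history `h`, together with all its data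
collectors:
* the source feeds all initial storage nodes with infinite capacity;
* every storage node has an edge of capacity `α` from its input to its output;
* the newcomer at time `l` receives an edge of capacity `β` from each storage node that is active
  at that time and whose physical node is a helper of the failed node `h l`;
* the data collector `S` has edges of infinite capacity from the finally active storage nodes
  whose physical node is in `S`. -/
noncomputable def ifgCapacity {N : Type*} (D : HelperScheme N) {τ : ℕ} (h : Fin τ → N) (k : ℕ)
    (α β : ℝ≥0∞) : IFGVertex N τ k → IFGVertex N τ k → ℝ≥0∞ :=
  open Classical in fun
    | .source, .inp (.inl _) => ⊤
    | .inp x, .out y => if x = y then α else 0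
    | .out x, .inp (.inr l) => if x.IsActive h l ∧ x.label h ∈ D (h l) then β else 0
    | .out x, .collector S => if x.IsActive h τ ∧ x.label h ∈ S.1 then ⊤ else 0
    | _, _ => 0

/-- All values `mincut_G(s, t)`, where `G` runs over the information flow graphs generated by `D`
(one for each finite failure history) and `t` over the data collectors of `G`. -/
def minCutValues {N : Type*} [Fintype N] (D : HelperScheme N) (k : ℕ) (α β : ℝ≥0∞) : Set ℝ≥0∞ :=
  {c | ∃ (τ : ℕ) (h : Fin τ → N) (S : {S : Finset N // S.card = k}),
    c = minCut (ifgCapacity D h k α β) .source (.collector S)}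

/-- The worst-case min-cut `min_G min_t mincut_G(s, t)` of a scheme. -/
noncomputable def worstMinCut {N : Type*} [Fintype N] (D : HelperScheme N) (k : ℕ)
    (α β : ℝ≥0∞) : ℝ≥0∞ :=
  sInf (minCutValues D k α β)

/-- The family helper selection scheme on the nodes `0, …, n - 1`.  Node `i` is in family
`i / (n - d)`; the families `0, …, n / (n - d) - 1` are complete.  A node of a complete family is
helped by all nodes outside its family, a node of the incomplete family by the first `d` nodes. -/
def familyScheme (n d : ℕ) : HelperScheme (Fin n) := fun i =>
  if i.val / (n - d) < n / (n - d) then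
    Finset.univ.filter fun j => j.val / (n - d) ≠ i.val / (n - d)
  else
    Finset.univ.filter fun j => j.val < d

/-- The scheme that splits the nodes `N` into `B` groups of sizes `m b`, with an arbitrary sorting
of the nodes inside each group (the sorted grouping is `e`), and applies the family helper
selection scheme inside each group. -/
def groupedFamilyScheme {N : Type*} {B : ℕ} (m : Fin B → ℕ) (d : ℕ)
    (e : N ≃ Σ b : Fin B, Fin (m b)) : HelperScheme N := fun x =>
  (familyScheme (m (e x).1) d (e x).2).map
    ((Function.Embedding.sigmaMk (e x).1).trans e.symm.toEmbedding)

/-- The number of groups of the family-plus scheme (a single one if `n ≤ 2 * d`). -/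
def familyPlusCount (n d : ℕ) : ℕ := max 1 (n / (2 * d))

/-- The group sizes of the family-plus scheme: all groups but the last have `2 * d` nodes, and the
last one has all the nodes that are left.  If `2 * d ∣ n`, the last one has size `2 * d` too;
otherwise it is the remaining group, and (for `n > 2 * d`) its size is the least possible one that
is at least `2 * d + 1`. -/
def familyPlusSize (n d : ℕ) (b : Fin (familyPlusCount n d)) : ℕ :=
  if b.val + 1 < familyPlusCount n d then 2 * d else n - 2 * d * (familyPlusCount n d - 1)

/-- The splittings `k = ∑ b, k_b` with `0 ≤ k_b ≤ m b`. -/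
def splittings {B : ℕ} (m : Fin B → ℕ) (k : ℕ) : Set (Fin B → ℕ) :=
  {κ | (∀ b, κ b ≤ m b) ∧ ∑ b, κ b = k}

/-- The groups of the family-plus scheme partition the `n` nodes. -/
theorem sum_familyPlusSize (n d : ℕ) : ∑ b, familyPlusSize n d b = n := by
  obtain ⟨c, hc⟩ : ∃ c, familyPlusCount n d = c + 1 :=
    ⟨familyPlusCount n d - 1, by unfold familyPlusCount; omega⟩
  have hle : 2 * d * c ≤ n := by
    have h1 : c ≤ n / (2 * d) := by
      unfold familyPlusCount at hc
      generalize n / (2 * d) = a at hc ⊢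
      omega
    exact le_trans (Nat.mul_le_mul_left _ h1) (Nat.mul_div_le n (2 * d))
  have key : ∀ q, q = c + 1 →
      ∑ b : Fin q, (if b.val + 1 < q then 2 * d else n - 2 * d * (q - 1)) = n := by
    rintro q rfl
    rw [Fin.sum_univ_castSucc]
    simp only [Fin.val_castSucc, Fin.val_last, lt_irrefl, if_false, Nat.add_sub_cancel]
    rw [Finset.sum_congr rfl (fun b _ => if_pos (by have := b.2; omega))]
    simp only [Finset.sum_const, Finset.card_univ, Fintype.card_fin, smul_eq_mul]
    rw [Nat.mul_comm c]
    omega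
  exact key _ hc

/-! A finite cut has all initial inputs on the source side, and the finally active outputs of the
accessed nodes on the other side. Once the sides of the outputs are fixed, the newcomers can be
treated one by one. One with its output on the source side costs nothing, since its input can join
it. One with its output on the other side costs either `α`, for its internal edge, or `β` for each
helper whose active output is on the source side. Only the set of nodes with active output on the
source side matters for later costs. Hence the worst-case min-cut over all histories is the least
cost of a `CutProcess` ending with `k` nodes off the source side: `exists_cutProcessCosts_le` turns
cuts into processes, `exists_minCutValues_le` turns processes into cuts.

The least cost exists because every cost is a natural combination of `α` and `β`, and `ℕ × ℕ` is
well-quasi-ordered.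

In a grouped scheme all helpers of a node lie in its own group, so a failure reads and changes the
state of one group only. A process therefore splits into independent processes of the groups with
the same total cost (`CutProcess.exists_split`), and any such processes can be run one after another
(`CutProcess.combine`). Counting the accessed nodes in each group gives the splitting of `k`.
Nothing else about the family scheme is needed. -/

/-- The transfers of a cut through an information flow graph, seen as a process in time.  The state
`A` is the set of physical nodes whose active copy has its output on the source side, and `c` is
the cost of the cut so far.  A failure of `i` either puts the output of the newcomer on the source
side, at no cost, or on the other side, at the cost `min α (β * #(D i ∩ A))`. -/
inductive CutProcess {N : Type*} (D : HelperScheme N) (α β : ℝ≥0∞) : Set N → ℝ≥0∞ → Prop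
  | start : CutProcess D α β Set.univ 0
  | add {A : Set N} {c : ℝ≥0∞} (i : N) (h : CutProcess D α β A c) :
      CutProcess D α β (insert i A) c
  | drop {A : Set N} {c : ℝ≥0∞} (i : N) (h : CutProcess D α β A c) :
      CutProcess D α β (A \ {i})
        (c + min α (β * (open Classical in ((D i).filter (· ∈ A)).card)))

/-- The costs of the cut processes that end with `k` nodes off the source side. -/
def cutProcessCosts {N : Type*} (D : HelperScheme N) (k : ℕ) (α β : ℝ≥0∞) : Set ℝ≥0∞ :=
  {c | ∃ A : Set N, CutProcess D α β A c ∧ ∃ S : Finset N, S.card = k ∧ ∀ i ∈ S, i ∉ A}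

/-! ### Cut processes and their costs. -/

section CutProcess

variable {N : Type*} {D : HelperScheme N} {α β : ℝ≥0∞}

theorem CutProcess.exists_nat {A : Set N} {c : ℝ≥0∞} (h : CutProcess D α β A c) :
    ∃ p : ℕ × ℕ, p.1 * α + p.2 * β = c := by
  induction h with
  | start => exact ⟨(0, 0), by simp⟩
  | add i h ih => exact ih
  | @drop A c i h ih =>
    obtain ⟨p, rfl⟩ := ih
    rcases min_choice α (β * (open Classical in ((D i).filter (· ∈ A)).card)) with h | h
    · exact ⟨(p.1 + 1, p.2), by rw [h]; push_cast; ring⟩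
    · exact ⟨(p.1, p.2 + (open Classical in ((D i).filter (· ∈ A)).card)), by
        rw [h]; push_cast; ring⟩

/-- Costs of cut processes are natural combinations of `α` and `β`, so a set of them has a least
element. -/
theorem exists_isLeast_cutProcessCosts {k : ℕ} (hne : (cutProcessCosts D k α β).Nonempty) :
    ∃ c, IsLeast (cutProcessCosts D k α β) c := by
  have hmono : Monotone fun p : ℕ × ℕ => (p.1 : ℝ≥0∞) * α + p.2 * β := by
    intro p q hpq
    have h1 : (p.1 : ℝ≥0∞) ≤ q.1 := by exact_mod_cast hpq.1
    have h2 : (p.2 : ℝ≥0∞) ≤ q.2 := by exact_mod_cast hpq.2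
    dsimp only
    gcongr
  -- Dickson's lemma: `ℕ × ℕ` is well-quasi-ordered, and this passes to monotone images. It works
  -- for infinite `α` or `β` too.
  have hpwo : (Set.range fun p : ℕ × ℕ => (p.1 : ℝ≥0∞) * α + p.2 * β).IsPWO := by
    rw [← Set.image_univ]
    exact (Set.isPWO_of_wellQuasiOrderedLE _).image_of_monotone hmono
  have hwf : (cutProcessCosts D k α β).IsWF :=
    (hpwo.mono (by rintro c ⟨A, hA, -⟩; exact hA.exists_nat)).isWF
  exact ⟨hwf.min hne, hwf.min_mem hne, fun c hc => hwf.min_le hne hc⟩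

/-- Dropping the nodes of `T` one by one costs at most `α` each. Besides showing that processes
exist, this imitates a cut through the internal edges of initial copies. -/
theorem CutProcess.exists_cost_le_of_compl (T : Finset N) :
    ∃ c ≤ T.card * α, CutProcess D α β {i | i ∉ T} c := by
  classical
  induction T using Finset.induction_on with
  | empty => exact ⟨0, by simp, by simpa using CutProcess.start⟩
  | insert i T hi ih =>
    obtain ⟨c, hc, h⟩ := ih
    have hset : {j | j ∉ insert i T} = {j | j ∉ T} \ {i} := by
      ext j
      simp only [Finset.mem_insert, Set.mem_ofPred_eq, Set.mem_sdiff, Set.mem_singleton_iff]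
      tauto
    rw [hset]
    refine ⟨_, ?_, h.drop i⟩
    rw [Finset.card_insert_of_notMem hi]
    push_cast
    rw [add_mul, one_mul]
    exact add_le_add hc (min_le_left _ _)

end CutProcess

/-! ### Edge capacities by type of endpoints. -/

section Capacity

variable {N : Type*} {τ : ℕ} (D : HelperScheme N) (h : Fin τ → N) (k : ℕ) (α β : ℝ≥0∞)

theorem ifgCapacity_to_source (u : IFGVertex N τ k) :
    ifgCapacity D h k α β u .source = 0 := by
  rcases u with _ | x | x | S <;> rfl

theorem ifgCapacity_from_collector (S : {S : Finset N // S.card = k}) (u : IFGVertex N τ k) :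
    ifgCapacity D h k α β (.collector S) u = 0 := by
  rcases u with _ | x | x | S <;> rfl

theorem ifgCapacity_source_inp_inl (i : N) :
    ifgCapacity D h k α β .source (.inp (.inl i)) = ⊤ :=
  rfl

theorem ifgCapacity_source_inp_inr (l : Fin τ) :
    ifgCapacity D h k α β .source (.inp (.inr l)) = 0 :=
  rfl

theorem ifgCapacity_source_out (x : StorageNode N τ) :
    ifgCapacity D h k α β .source (.out x) = 0 :=
  rfl

theorem ifgCapacity_source_collector (S : {S : Finset N // S.card = k}) :
    ifgCapacity D h k α β .source (.collector S) = 0 :=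
  rfl

theorem ifgCapacity_inp_inp (x y : StorageNode N τ) :
    ifgCapacity D h k α β (.inp x) (.inp y) = 0 := by
  rcases y with i | l <;> rfl

theorem ifgCapacity_inp_collector (x : StorageNode N τ) (S : {S : Finset N // S.card = k}) :
    ifgCapacity D h k α β (.inp x) (.collector S) = 0 :=
  rfl

theorem ifgCapacity_out_inp_inl (x : StorageNode N τ) (i : N) :
    ifgCapacity D h k α β (.out x) (.inp (.inl i)) = 0 :=
  rfl

theorem ifgCapacity_out_out (x y : StorageNode N τ) :
    ifgCapacity D h k α β (.out x) (.out y) = 0 :=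
  rfl

open Classical in
theorem ifgCapacity_inp_out (x y : StorageNode N τ) :
    ifgCapacity D h k α β (.inp x) (.out y) = if x = y then α else 0 :=
  rfl

open Classical in
theorem ifgCapacity_out_inp_inr (x : StorageNode N τ) (l : Fin τ) :
    ifgCapacity D h k α β (.out x) (.inp (.inr l)) = if x.IsActive h l ∧ x.label h ∈ D (h l) then β else 0 :=
  rfl

open Classical in
theorem ifgCapacity_out_collector (x : StorageNode N τ) (S : {S : Finset N // S.card = k}) :
    ifgCapacity D h k α β (.out x) (.collector S) = if x.IsActive h τ ∧ x.label h ∈ S.1 then ⊤ else 0 :=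
  rfl

end Capacity

/-! ### Cuts of information flow graphs against cut processes. -/

section InformationFlowGraph

variable {N : Type*} {τ : ℕ} {h : Fin τ → N}

theorem StorageNode.isActive_succ (l : Fin τ) (x : StorageNode N τ) :
    x.IsActive h (l.val + 1) ↔ x.IsActive h l.val ∧ x.label h ≠ h l ∨ x = .inr l := by
  rcases x with i | j
  · simp only [StorageNode.IsActive, StorageNode.label]
    constructor
    · intro H
      exact .inl ⟨fun j hj => H j (by omega), fun he => H l (by omega) he.symm⟩
    · rintro (⟨H, H'⟩ | H) j hj
      · rcases Nat.lt_succ_iff_lt_or_eq.1 hj with hj | hj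
        · exact H j hj
        · rw [Fin.ext hj]; exact fun he => H' he.symm
      · cases H
  · simp only [StorageNode.IsActive, StorageNode.label, Sum.inr.injEq]
    constructor
    · rintro ⟨H, H'⟩
      by_cases hjl : j = l
      · exact .inr hjl
      · have : j.val ≠ l.val := fun he => hjl (Fin.ext he)
        have hlt : j < l := by rw [Fin.lt_def]; omega
        exact .inl ⟨⟨by omega, fun a ha hb => H' a ha (by omega)⟩,
          fun he => H' l hlt (by omega) he.symm⟩
    · rintro (⟨⟨H, H'⟩, H''⟩ | rfl)
      · refine ⟨by omega, fun a ha hb => ?_⟩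
        rcases Nat.lt_succ_iff_lt_or_eq.1 hb with hb | hb
        · exact H' a ha hb
        · rw [Fin.ext hb]; exact fun he => H'' he.symm
      · exact ⟨by omega, fun a ha hb => by rw [Fin.lt_def] at ha; omega⟩

theorem StorageNode.label_injOn_isActive (l : ℕ) :
    Set.InjOn (StorageNode.label h) {x | x.IsActive h l} := by
  rintro (i | i) hi (j | j) hj hij <;>
    simp only [StorageNode.IsActive, StorageNode.label, Set.mem_ofPred_eq] at hi hj hij
  · rw [hij]
  · exact absurd hij.symm (hi j hj.1)
  · exact absurd hij (hj i hi.1)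
  · rcases lt_trichotomy i j with hlt | rfl | hlt
    · exact absurd hij.symm (hi.2 j hlt hj.1)
    · rfl
    · exact absurd hij (hj.2 i hlt hi.1)

variable {k : ℕ}

/-- The set of the physical nodes whose copy active at time `l` has its output in `U`. -/
def activeOutputs (h : Fin τ → N) (U : Set (IFGVertex N τ k)) (l : ℕ) : Set N :=
  {i | ∃ x : StorageNode N τ, x.IsActive h l ∧ x.label h = i ∧ .out x ∈ U}

theorem activeOutputs_succ (U : Set (IFGVertex N τ k)) (l : Fin τ) :
    activeOutputs h U (l + 1) =
      (open Classical in if .out (.inr l) ∈ U then insert (h l) (activeOutputs h U l)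
        else activeOutputs h U l \ {h l}) := by
  ext i
  have key : i ∈ activeOutputs h U (l + 1) ↔
      i ∈ activeOutputs h U l ∧ i ≠ h l ∨ i = h l ∧ .out (.inr l) ∈ U := by
    simp only [activeOutputs, Set.mem_ofPred_eq, StorageNode.isActive_succ]
    constructor
    · rintro ⟨x, ⟨hx, hx'⟩ | rfl, rfl, hU⟩
      · exact .inl ⟨⟨x, hx, rfl, hU⟩, hx'⟩
      · exact .inr ⟨rfl, hU⟩
    · rintro (⟨⟨x, hx, rfl, hU⟩, hx'⟩ | ⟨rfl, hU⟩)
      · exact ⟨x, .inl ⟨hx, hx'⟩, rfl, hU⟩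
      · exact ⟨.inr l, .inr rfl, rfl, hU⟩
  rw [key]
  split_ifs with hU
  · simp only [hU, Set.mem_insert_iff]
    tauto
  · simp [hU]

open Classical in
-- Unrolls a process into a failure history and a sequence of states, the form from which a cut can
-- be built.
theorem CutProcess.exists_history {D : HelperScheme N} {α β : ℝ≥0∞} {A : Set N} {c : ℝ≥0∞}
    (H : CutProcess D α β A c) :
    ∃ (τ : ℕ) (h : Fin τ → N) (A' : ℕ → Set N), A' 0 = Set.univ ∧ A' τ = A ∧
      (∀ l : Fin τ, ∀ i, i ≠ h l → (i ∈ A' (l + 1) ↔ i ∈ A' l)) ∧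
      ∑ l : Fin τ, (if h l ∈ A' (l + 1) then 0
        else min α (β * ((D (h l)).filter (· ∈ A' l)).card)) = c := by
  -- Appending one failure of `i`. Whether `i` lies in the new state `A₂` decides the cost, so `add`
  -- and `drop` are covered together.
  have extend : ∀ (A₁ A₂ : Set N) (c : ℝ≥0∞) (i : N), (∀ j, j ≠ i → (j ∈ A₂ ↔ j ∈ A₁)) →
      (∃ (τ : ℕ) (h : Fin τ → N) (A' : ℕ → Set N), A' 0 = Set.univ ∧ A' τ = A₁ ∧
        (∀ l : Fin τ, ∀ i, i ≠ h l → (i ∈ A' (l + 1) ↔ i ∈ A' l)) ∧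
        ∑ l : Fin τ, (if h l ∈ A' (l + 1) then 0
          else min α (β * ((D (h l)).filter (· ∈ A' l)).card)) = c) →
      ∃ (τ : ℕ) (h : Fin τ → N) (A' : ℕ → Set N), A' 0 = Set.univ ∧ A' τ = A₂ ∧
        (∀ l : Fin τ, ∀ i, i ≠ h l → (i ∈ A' (l + 1) ↔ i ∈ A' l)) ∧
        ∑ l : Fin τ, (if h l ∈ A' (l + 1) then 0
          else min α (β * ((D (h l)).filter (· ∈ A' l)).card)) =
          c + if i ∈ A₂ then 0 else min α (β * ((D i).filter (· ∈ A₁)).card) := by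
    rintro A₁ A₂ c i hi ⟨τ, h, A', h0, h1, h2, h3⟩
    have hlt : ∀ l : Fin τ, Function.update A' (τ + 1) A₂ l = A' l := fun l =>
      Function.update_of_ne (by omega) _ _
    have hlt' : ∀ l : Fin τ, Function.update A' (τ + 1) A₂ (l + 1) = A' (l + 1) := fun l =>
      Function.update_of_ne (by omega) _ _
    have hτ : Function.update A' (τ + 1) A₂ τ = A₁ := by
      rw [Function.update_of_ne (by omega), h1]
    refine ⟨τ + 1, Fin.snoc h i, Function.update A' (τ + 1) A₂, ?_, ?_, ?_, ?_⟩
    · rw [Function.update_of_ne (by omega), h0]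
    · rw [Function.update_self]
    · intro l
      refine Fin.lastCases ?_ (fun l => ?_) l
      · simpa [hτ, h1] using hi
      · simpa [hlt, hlt'] using h2 l
    · rw [Fin.sum_univ_castSucc]
      simp only [Fin.snoc_castSucc, Fin.snoc_last, Fin.val_castSucc, Fin.val_last, hlt, hlt', hτ,
        Function.update_self, h3]
  induction H with
  | start => exact ⟨0, Fin.elim0, fun _ => Set.univ, rfl, rfl, fun l => l.elim0, by simp⟩
  | @add A c i h ih =>
    have := extend A (insert i A) c i (fun j hj => by simp [hj]) ih
    simpa using this
  | @drop A c i h ih =>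
    have := extend A (A \ {i}) c i (fun j hj => by simp [hj]) ih
    simpa using this

variable [Fintype N]

theorem IFGVertex.sum_eq {M : Type*} [AddCommMonoid M] (f : IFGVertex N τ k → M) :
    ∑ v, f v = f .source + (∑ x, f (.inp x) + (∑ x, f (.out x) + ∑ S, f (.collector S))) := by
  rw [← (IFGVertex.equivSum N τ k).symm.sum_comp]
  simp [Fintype.sum_sum_type, IFGVertex.equivSum]

open Classical in
/-- The value of a cut, sorted by the heads of the edges. -/
theorem cutValue_ifgCapacity (D : HelperScheme N) (h : Fin τ → N) (α β : ℝ≥0∞)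
    (U : Set (IFGVertex N τ k)) :
    cutValue (ifgCapacity D h k α β) U =
      ∑ i : N, (if .source ∈ U ∧ .inp (.inl i) ∉ U then ⊤ else 0) +
      ∑ l : Fin τ, (if .inp (.inr l) ∉ U then
        β * (Finset.univ.filter fun x : StorageNode N τ =>
          .out x ∈ U ∧ x.IsActive h l ∧ x.label h ∈ D (h l)).card else 0) +
      (∑ i : N, (if .inp (.inl i) ∈ U ∧ .out (.inl i) ∉ U then α else 0) +
        ∑ l : Fin τ, (if .inp (.inr l) ∈ U ∧ .out (.inr l) ∉ U then α else 0)) +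
      ∑ S : {S : Finset N // S.card = k}, ∑ x : StorageNode N τ,
        (if .out x ∈ U ∧ .collector S ∉ U ∧ x.IsActive h τ ∧ x.label h ∈ S.1 then ⊤ else 0) := by
  unfold cutValue
  rw [Finset.sum_comm, IFGVertex.sum_eq]
  rw [Fintype.sum_sum_type]
  simp only [IFGVertex.sum_eq,
    ifgCapacity_to_source, ifgCapacity_from_collector, ifgCapacity_source_inp_inl,
    ifgCapacity_source_inp_inr, ifgCapacity_source_out, ifgCapacity_source_collector,
    ifgCapacity_inp_inp, ifgCapacity_inp_collector, ifgCapacity_out_inp_inl,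
    ifgCapacity_out_out, ifgCapacity_inp_out, ifgCapacity_out_inp_inr,
    ifgCapacity_out_collector,
    ite_self, Finset.sum_const_zero, add_zero, zero_add]
  refine (add_assoc _ _ _).symm.trans ?_
  congr 1
  · congr 1
    · congr 1
      refine Finset.sum_congr rfl fun l _ => ?_
      split_ifs with hl
      · simp [hl]
      · rw [mul_comm, ← nsmul_eq_mul, ← Finset.sum_const, Finset.sum_filter]
        refine Finset.sum_congr rfl fun x _ => ?_
        simp only [hl, not_false_eq_true, and_true, ← ite_and]
    · refine Eq.trans ?_ (Fintype.sum_sum_type fun x : StorageNode N τ =>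
        if IFGVertex.inp x ∈ U ∧ IFGVertex.out x ∉ U then α else 0)
      refine Finset.sum_congr rfl fun x _ => ?_
      rw [Finset.sum_eq_single x]
      · simp
      · intro y _ hy
        simp [hy]
      · simp
  · refine Finset.sum_congr rfl fun S _ => Finset.sum_congr rfl fun x _ => ?_
    simp only [← ite_and, and_assoc]

open Classical in
/-- Every cut of an information flow graph contains the cost of a cut process. -/
theorem exists_cutProcess_le_cutValue (D : HelperScheme N) (h : Fin τ → N) (α β : ℝ≥0∞)
    (U : Set (IFGVertex N τ k)) (hU : ∀ i, .inp (.inl i) ∈ U) :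
    ∃ c ≤ cutValue (ifgCapacity D h k α β) U, CutProcess D α β (activeOutputs h U τ) c := by
  -- `nc l` is the part of the cut charged to the newcomer at time `l`, and `c₀` below is the part
  -- charged to the initial copies.
  set nc : Fin τ → ℝ≥0∞ := fun l =>
    (if .inp (.inr l) ∉ U then β * (Finset.univ.filter fun x : StorageNode N τ =>
      .out x ∈ U ∧ x.IsActive h l ∧ x.label h ∈ D (h l)).card else 0) +
    (if .inp (.inr l) ∈ U ∧ .out (.inr l) ∉ U then α else 0) with hnc
  set c₀ : ℝ≥0∞ := ∑ i : N, (if .inp (.inl i) ∈ U ∧ .out (.inl i) ∉ U then α else 0) with hc₀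
  have hcut : c₀ + ∑ l, nc l ≤ cutValue (ifgCapacity D h k α β) U := by
    rw [cutValue_ifgCapacity, hnc, Finset.sum_add_distrib]
    refine le_trans (le_of_eq ?_) le_self_add
    simp only [hU, not_true_eq_false, and_false, if_false, Finset.sum_const_zero, zero_add]
    simp only [hc₀, hU]
    ring
  have key : ∀ l : ℕ, l ≤ τ → ∃ c ≤ c₀ + ∑ j : Fin τ, (if j.val < l then nc j else 0),
      CutProcess D α β (activeOutputs h U l) c := by
    intro l
    induction l with
    | zero =>
      intro _
      -- Initial copies with output off the source side are imitated by extra failures before the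
      -- history begins, paid for by `c₀`.
      obtain ⟨c, hc, H⟩ := CutProcess.exists_cost_le_of_compl (D := D) (α := α) (β := β)
        (Finset.univ.filter fun i : N => (.out (.inl i) : IFGVertex N τ k) ∉ U)
      refine ⟨c, ?_, ?_⟩
      · refine hc.trans (le_of_eq ?_)
        simp only [hc₀, hU, true_and, ← Finset.sum_filter, Finset.sum_const, nsmul_eq_mul]
        simp
      · convert H using 1
        ext i
        simp only [activeOutputs, Set.mem_ofPred_eq, Finset.mem_filter, Finset.mem_univ, true_and,
          not_not]
        constructor
        · rintro ⟨i | j, hx, rfl, hU⟩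
          · exact hU
          · exact absurd hx.1 (by omega)
        · intro hi
          exact ⟨.inl i, fun j hj => absurd hj (by omega), rfl, hi⟩
    | succ l ih =>
      intro hl
      obtain ⟨c, hc, H⟩ := ih (by omega)
      have hsum : ∑ j : Fin τ, (if j.val < l + 1 then nc j else 0) =
          ∑ j : Fin τ, (if j.val < l then nc j else 0) + nc ⟨l, hl⟩ := by
        rw [← Finset.sum_erase_add _ _ (Finset.mem_univ (⟨l, hl⟩ : Fin τ)),
          ← Finset.sum_erase_add _ (fun j : Fin τ => if j.val < l then nc j else 0)
            (Finset.mem_univ (⟨l, hl⟩ : Fin τ))]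
        simp only [lt_irrefl, if_false, add_zero, Nat.lt_succ_self, if_true]
        congr 1
        refine Finset.sum_congr rfl fun j hj => ?_
        have : j.val ≠ l := fun he => Finset.ne_of_mem_erase hj (Fin.ext he)
        have h' : j.val < l + 1 ↔ j.val < l := by omega
        simp only [h']
      rw [activeOutputs_succ U ⟨l, hl⟩, hsum, ← add_assoc]
      by_cases ho : (.out (.inr ⟨l, hl⟩) : IFGVertex N τ k) ∈ U
      · rw [if_pos ho]
        exact ⟨c, hc.trans le_self_add, H.add _⟩
      · rw [if_neg ho]
        refine ⟨_, ?_, H.drop _⟩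
        refine add_le_add hc ?_
        simp only [hnc]
        by_cases hi : (.inp (.inr ⟨l, hl⟩) : IFGVertex N τ k) ∈ U
        · simp only [hi, ho, not_true_eq_false, not_false_eq_true, and_self, if_true, if_false,
            zero_add]
          exact min_le_left _ _
        · simp only [hi, not_false_eq_true, false_and, if_true, if_false, add_zero]
          refine (min_le_right _ _).trans ?_
          gcongr
          -- Each helper in the state has at least one active copy with output in `U`, so it is the
          -- label of a counted storage node.
          refine le_trans (Finset.card_le_card ?_)
            (Finset.card_image_le (f := StorageNode.label h))
          intro i hi
          obtain ⟨hiD, x, hx, rfl, hxU⟩ := Finset.mem_filter.1 hi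
          exact Finset.mem_image.2 ⟨x, by simp [hx, hxU, hiD], rfl⟩
  obtain ⟨c, hc, H⟩ := key τ le_rfl
  refine ⟨c, (hc.trans (le_of_eq ?_)).trans hcut, H⟩
  simp

theorem exists_cutValue_eq_minCut {V : Type*} [Fintype V] (cap : V → V → ℝ≥0∞) {s t : V}
    (hst : s ≠ t) : ∃ U : Set V, s ∈ U ∧ t ∉ U ∧ cutValue cap U = minCut cap s t := by
  have : Nonempty {U : Set V // s ∈ U ∧ t ∉ U} := ⟨⟨{s}, rfl, fun h => hst h.symm⟩⟩
  obtain ⟨U, hU⟩ := exists_eq_ciInf_of_finite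
    (f := fun U : {U : Set V // s ∈ U ∧ t ∉ U} => cutValue cap U.1)
  exact ⟨U.1, U.2.1, U.2.2, hU⟩

theorem cutProcessCosts_nonempty (D : HelperScheme N) (hk : k ≤ Fintype.card N) (α β : ℝ≥0∞) :
    (cutProcessCosts D k α β).Nonempty := by
  obtain ⟨S, -, hS⟩ := Finset.exists_subset_card_eq (s := (Finset.univ : Finset N)) hk
  obtain ⟨c, -, hc⟩ := CutProcess.exists_cost_le_of_compl (D := D) (α := α) (β := β) S
  exact ⟨c, _, hc, S, hS, fun i hi h => h hi⟩

theorem exists_cutProcessCosts_le (D : HelperScheme N) (hk : k ≤ Fintype.card N) {α β v : ℝ≥0∞}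
    (hv : v ∈ minCutValues D k α β) : ∃ c ∈ cutProcessCosts D k α β, c ≤ v := by
  classical
  obtain ⟨τ, h, S, rfl⟩ := hv
  obtain ⟨U, hs, ht, hU⟩ := exists_cutValue_eq_minCut (ifgCapacity D h k α β)
    (s := .source) (t := .collector S) (by simp)
  rw [← hU]
  -- An infinite cut bounds any cost. A finite one contains no edge of infinite capacity, which
  -- yields both the initial inputs in `U` and the disjointness of `S` from the final state.
  by_cases htop : cutValue (ifgCapacity D h k α β) U = ⊤
  · obtain ⟨c, hc⟩ := cutProcessCosts_nonempty D hk α β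
    exact ⟨c, hc, htop ▸ le_top⟩
  · have hfin := htop
    rw [cutValue_ifgCapacity] at hfin
    simp only [ENNReal.add_eq_top, ENNReal.sum_eq_top, not_or, not_exists, not_and] at hfin
    obtain ⟨⟨⟨h1, -⟩, -⟩, h2⟩ := hfin
    have hinp : ∀ i, .inp (.inl i) ∈ U := by
      intro i
      by_contra hi
      exact h1 i (Finset.mem_univ _) (by simp [hs, hi])
    obtain ⟨c, hc, H⟩ := exists_cutProcess_le_cutValue D h α β U hinp
    refine ⟨c, ⟨_, H, S.1, S.2, ?_⟩, hc⟩
    rintro i hi ⟨x, hx, rfl, hxU⟩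
    exact h2 S (Finset.mem_univ _) x (Finset.mem_univ _) (by simp [hxU, ht, hx, hi])

open Classical in
/-- The cut of an information flow graph that belongs to a sequence of states. -/
theorem minCut_le_sum (D : HelperScheme N) (h : Fin τ → N) (α β : ℝ≥0∞) (A : ℕ → Set N)
    (h0 : A 0 = Set.univ) (hA : ∀ l : Fin τ, ∀ i, i ≠ h l → (i ∈ A (l + 1) ↔ i ∈ A l))
    (S : {S : Finset N // S.card = k}) (hS : ∀ i ∈ S.1, i ∉ A τ) :
    minCut (ifgCapacity D h k α β) .source (.collector S) ≤
      ∑ l : Fin τ, if h l ∈ A (l + 1) then 0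
        else min α (β * ((D (h l)).filter (· ∈ A l)).card) := by
  -- Outputs of newcomers follow the states. The input of a dropped newcomer goes to the source side
  -- exactly when its internal edge is no dearer than the edges from its helpers.
  obtain ⟨U, hs, hii, hoi, hir, hor, hc⟩ : ∃ U : Set (IFGVertex N τ k), .source ∈ U ∧
      (∀ i, .inp (.inl i) ∈ U) ∧ (∀ i, .out (.inl i) ∈ U) ∧
      (∀ l, .inp (.inr l) ∈ U ↔
        h l ∈ A (l + 1) ∨ α ≤ β * ((D (h l)).filter (· ∈ A l)).card) ∧
      (∀ l, .out (.inr l) ∈ U ↔ h l ∈ A (l + 1)) ∧ ∀ S', .collector S' ∈ U ↔ S' ≠ S :=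
    ⟨{v | match v with
      | .source => True
      | .inp (.inl _) => True
      | .inp (.inr l) => h l ∈ A (l + 1) ∨ α ≤ β * ((D (h l)).filter (· ∈ A l)).card
      | .out (.inl _) => True
      | .out (.inr l) => h l ∈ A (l + 1)
      | .collector S' => S' ≠ S},
      trivial, fun _ => trivial, fun _ => trivial, fun _ => Iff.rfl, fun _ => Iff.rfl,
      fun _ => Iff.rfl⟩
  have hact : ∀ l ≤ τ, ∀ x : StorageNode N τ, x.IsActive h l →
      (.out x ∈ U ↔ x.label h ∈ A l) := by
    intro l
    induction l with
    | zero =>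
      rintro - (i | j) hx
      · simp [hoi, h0]
      · exact absurd hx.1 (by omega)
    | succ l ih =>
      intro hl x hx
      rcases (StorageNode.isActive_succ ⟨l, hl⟩ x).1 hx with ⟨hx, hne⟩ | rfl
      · rw [ih (by omega) x hx]
        exact (hA ⟨l, hl⟩ _ hne).symm
      · exact hor _
  refine (iInf_le _ ⟨U, hs, fun hn => (hc S).1 hn rfl⟩).trans ?_
  dsimp only
  rw [cutValue_ifgCapacity]
  have e1 : ∑ i : N, (if .source ∈ U ∧ .inp (.inl i) ∉ U then (⊤ : ℝ≥0∞) else 0) = 0 := by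
    simp [hii]
  have e2 : ∑ i : N, (if .inp (.inl i) ∈ U ∧ .out (.inl i) ∉ U then α else 0) = 0 := by
    simp [hoi]
  have e3 : ∑ S : {S : Finset N // S.card = k}, ∑ x : StorageNode N τ,
      (if .out x ∈ U ∧ .collector S ∉ U ∧ x.IsActive h τ ∧ x.label h ∈ S.1 then
        (⊤ : ℝ≥0∞) else 0) = 0 := by
    refine Finset.sum_eq_zero fun S' _ => Finset.sum_eq_zero fun x _ => if_neg ?_
    rintro ⟨hx, hS', ha, hl⟩
    rw [hc, not_not] at hS'
    subst hS'
    exact hS _ hl ((hact τ le_rfl x ha).1 hx)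
  rw [e1, e2, e3, zero_add, zero_add, add_zero, ← Finset.sum_add_distrib]
  refine Finset.sum_le_sum fun l _ => ?_
  -- A node has at most one active copy at a time, so no helper is counted twice.
  have hcard : (Finset.univ.filter fun x : StorageNode N τ =>
      .out x ∈ U ∧ x.IsActive h l ∧ x.label h ∈ D (h l)).card ≤
      ((D (h l)).filter (· ∈ A l)).card := by
    refine Finset.card_le_card_of_injOn (StorageNode.label h) ?_ ?_
    · intro x hx
      obtain ⟨-, hx, hx', hx''⟩ := Finset.mem_filter.1 hx
      exact Finset.mem_filter.2 ⟨hx'', (hact l l.2.le x hx').1 hx⟩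
    · exact (StorageNode.label_injOn_isActive l.val).mono fun x hx =>
        (Finset.mem_filter.1 hx).2.2.1
  by_cases ho : h l ∈ A (l + 1)
  · simp [hir, hor, ho]
  · by_cases hi : α ≤ β * ((D (h l)).filter (· ∈ A l)).card
    · simp only [hir, hor, ho, hi, or_true, not_true_eq_false, if_false, not_false_eq_true,
        and_self, if_true, zero_add, min_eq_left hi, le_refl]
    · simp only [hir, hor, ho, hi, or_self, not_false_eq_true, if_true, false_and, if_false,
        add_zero, min_eq_right (not_le.1 hi).le]
      gcongr

theorem exists_minCutValues_le (D : HelperScheme N) {α β c : ℝ≥0∞}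
    (hc : c ∈ cutProcessCosts D k α β) : ∃ v ∈ minCutValues D k α β, v ≤ c := by
  obtain ⟨A, H, S, hS, hSA⟩ := hc
  obtain ⟨τ, h, A', h0, h1, h2, rfl⟩ := H.exists_history
  exact ⟨_, ⟨τ, h, ⟨S, hS⟩, rfl⟩, minCut_le_sum D h α β A' h0 h2 ⟨S, hS⟩ (by rwa [h1])⟩

/-- The worst-case min-cut is attained, and it is the least cost of a cut process. -/
theorem isLeast_worstMinCut (D : HelperScheme N) (hk : k ≤ Fintype.card N) (α β : ℝ≥0∞) :
    IsLeast (minCutValues D k α β) (worstMinCut D k α β) ∧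
      IsLeast (cutProcessCosts D k α β) (worstMinCut D k α β) := by
  obtain ⟨c, hc⟩ := exists_isLeast_cutProcessCosts (cutProcessCosts_nonempty D hk α β)
  have hlow : c ∈ lowerBounds (minCutValues D k α β) := by
    intro v hv
    obtain ⟨c', hc', hle⟩ := exists_cutProcessCosts_le D hk hv
    exact (hc.2 hc').trans hle
  obtain ⟨v, hv, hvc⟩ := exists_minCutValues_le D hc.1
  obtain rfl : v = c := le_antisymm hvc (hlow hv)
  have hv' : IsLeast (minCutValues D k α β) v := ⟨hv, hlow⟩
  have : worstMinCut D k α β = v := hv'.csInf_eq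
  rw [this]
  exact ⟨hv', hc⟩

end InformationFlowGraph

/-! ### Splitting and combining processes along groups. -/

section Grouping

variable {N : Type*} {ι : Type*} {M : ι → Type*} {G : HelperScheme N}
  {D : ∀ b, HelperScheme (M b)} {e : N ≃ Σ b, M b} {α β : ℝ≥0∞}

open Classical in
-- The cost of a drop sees only the state of the node's own group, because all helpers lie there.
theorem card_filter_helpers_of_grouping
    (hG : ∀ b y, G (e.symm ⟨b, y⟩) =
      (D b y).map ((Function.Embedding.sigmaMk b).trans e.symm.toEmbedding))
    {A : Set N} {b : ι} (y : M b) {A' : Set (M b)} (hA : ∀ z, e.symm ⟨b, z⟩ ∈ A ↔ z ∈ A') :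
    ((G (e.symm ⟨b, y⟩)).filter (· ∈ A)).card =
      ((D b y).filter (· ∈ A')).card := by
  rw [hG, Finset.filter_map, Finset.card_map]
  simp only [← hA]
  rfl

/-- Each step is charged to the group of its node; the states and costs of the other groups do not
move. -/
theorem CutProcess.exists_split [Fintype ι]
    (hG : ∀ b y, G (e.symm ⟨b, y⟩) =
      (D b y).map ((Function.Embedding.sigmaMk b).trans e.symm.toEmbedding))
    {A : Set N} {c : ℝ≥0∞} (H : CutProcess G α β A c) :
    ∃ γ : ι → ℝ≥0∞, (∀ b, CutProcess (D b) α β {y | e.symm ⟨b, y⟩ ∈ A} (γ b)) ∧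
      ∑ b, γ b = c := by
  classical
  induction H with
  | start => exact ⟨0, fun b => by simpa using CutProcess.start, by simp⟩
  | @add A c i h ih =>
    obtain ⟨γ, hγ, rfl⟩ := ih
    obtain ⟨⟨b, y⟩, rfl⟩ := e.symm.surjective i
    refine ⟨γ, fun b' => ?_, rfl⟩
    by_cases hb : b' = b
    · subst hb
      convert (hγ b').add y using 1
      ext z
      simp
    · convert hγ b' using 1
      ext z
      simp [hb]
  | @drop A c i h ih =>
    obtain ⟨γ, hγ, rfl⟩ := ih
    obtain ⟨⟨b, y⟩, rfl⟩ := e.symm.surjective i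
    rw [card_filter_helpers_of_grouping hG y (A := A)
      (A' := {z | e.symm ⟨b, z⟩ ∈ A}) fun _ => Iff.rfl]
    refine ⟨γ + Pi.single b (min α (β * ((D b y).filter
      (· ∈ {z | e.symm ⟨b, z⟩ ∈ A})).card)), fun b' => ?_, ?_⟩
    · by_cases hb : b' = b
      · subst hb
        rw [Pi.add_apply, Pi.single_eq_same]
        convert (hγ b').drop y using 1
        ext z
        simp
      · rw [Pi.add_apply, Pi.single_eq_of_ne hb, add_zero]
        convert hγ b' using 1
        ext z
        simp [hb]
    · simp only [Pi.add_apply, Finset.sum_add_distrib]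
      congr 1
      rw [Finset.sum_pi_single']
      simp

/-- A cut process of one group can be run after any cut process that has not touched the group. -/
theorem CutProcess.extend_group
    (hG : ∀ b y, G (e.symm ⟨b, y⟩) =
      (D b y).map ((Function.Embedding.sigmaMk b).trans e.symm.toEmbedding))
    {X : Set N} {c₀ : ℝ≥0∞} (HX : CutProcess G α β X c₀) {b : ι}
    (hX : ∀ y, e.symm ⟨b, y⟩ ∈ X) {A : Set (M b)} {c : ℝ≥0∞} (H : CutProcess (D b) α β A c) :
    CutProcess G α β (X \ (fun y => e.symm ⟨b, y⟩) '' Aᶜ) (c₀ + c) := by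
  have hinj : ∀ y z : M b, e.symm ⟨b, y⟩ = e.symm ⟨b, z⟩ ↔ y = z := by simp
  induction H with
  | start => simpa using HX
  | @add A c y h ih =>
    convert ih.add (e.symm ⟨b, y⟩) using 1
    ext i
    simp only [Set.mem_sdiff, Set.mem_image, Set.mem_compl_iff, Set.mem_insert_iff, not_exists,
      not_and]
    constructor
    · rintro ⟨hi, h'⟩
      by_cases hiy : i = e.symm ⟨b, y⟩
      · exact .inl hiy
      · refine .inr ⟨hi, fun z hz hzi => h' z ?_ hzi⟩
        rintro (rfl | hzA)
        · exact hiy hzi.symm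
        · exact hz hzA
    · rintro (rfl | ⟨hi, h'⟩)
      · exact ⟨hX y, fun z hz hzy => hz (.inl ((hinj _ _).1 hzy))⟩
      · exact ⟨hi, fun z hz => h' z fun hzA => hz (.inr hzA)⟩
  | @drop A c y h ih =>
    have hst : ∀ z, e.symm ⟨b, z⟩ ∈ X \ (fun y => e.symm ⟨b, y⟩) '' Aᶜ ↔ z ∈ A := by
      simp [hX]
    have := ih.drop (e.symm ⟨b, y⟩)
    rw [card_filter_helpers_of_grouping hG y hst, add_assoc] at this
    convert this using 1
    ext i
    simp only [Set.mem_sdiff, Set.mem_image, Set.mem_compl_iff, Set.mem_singleton_iff]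
    constructor
    · rintro ⟨hi, h'⟩
      exact ⟨⟨hi, fun ⟨z, hz, hzi⟩ => h' ⟨z, fun hzA => hz hzA.1, hzi⟩⟩,
        fun hiy => h' ⟨y, fun hy => hy.2 rfl, hiy.symm⟩⟩
    · rintro ⟨⟨hi, h'⟩, hiy⟩
      refine ⟨hi, fun ⟨z, hz, hzi⟩ => ?_⟩
      by_cases hzA : z ∈ A
      · refine hz ⟨hzA, ?_⟩
        rintro rfl
        exact hiy hzi.symm
      · exact h' ⟨z, hzA, hzi⟩

/-- The groups are run one after another; a group still waiting is entirely on the source side, as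
`CutProcess.extend_group` requires. -/
theorem CutProcess.combine [Fintype ι]
    (hG : ∀ b y, G (e.symm ⟨b, y⟩) =
      (D b y).map ((Function.Embedding.sigmaMk b).trans e.symm.toEmbedding))
    {A : ∀ b, Set (M b)} {γ : ι → ℝ≥0∞} (H : ∀ b, CutProcess (D b) α β (A b) (γ b)) :
    CutProcess G α β {i | (e i).2 ∈ A (e i).1} (∑ b, γ b) := by
  classical
  -- `T` is the set of groups already run.
  have key : ∀ T : Finset ι,
      CutProcess G α β {i | (e i).1 ∈ T → (e i).2 ∈ A (e i).1} (∑ b ∈ T, γ b) := by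
    intro T
    induction T using Finset.induction_on with
    | empty => simpa using CutProcess.start
    | insert b T hb ih =>
      rw [Finset.sum_insert hb, add_comm]
      convert CutProcess.extend_group hG ih (b := b) (fun y => by simp [hb]) (H b) using 1
      ext i
      obtain ⟨⟨b', y⟩, rfl⟩ := e.symm.surjective i
      simp only [Set.mem_sdiff, Set.mem_ofPred_eq]
      rw [Equiv.apply_symm_apply]
      by_cases hbb : b' = b
      · subst hbb
        simp [hb]
      · have : b ≠ b' := fun h => hbb h.symm
        simp [hbb, this]
  simpa using key Finset.univ

end Grouping

/-- The worst-case min-cut of a grouped scheme is the least sum of worst-case min-cuts of the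
groups. -/
theorem isLeast_worstMinCut_of_grouping {N : Type*} [Fintype N] {B : ℕ} {m : Fin B → ℕ}
    (G : HelperScheme N) (D : ∀ b, HelperScheme (Fin (m b))) (e : N ≃ Σ b, Fin (m b))
    (hG : ∀ b y, G (e.symm ⟨b, y⟩) =
      (D b y).map ((Function.Embedding.sigmaMk b).trans e.symm.toEmbedding))
    {k : ℕ} (hk : k ≤ Fintype.card N) (α β : ℝ≥0∞) :
    IsLeast ((fun κ : Fin B → ℕ => ∑ b, worstMinCut (D b) (κ b) α β) '' splittings m k)
      (worstMinCut G k α β) := by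
  classical
  have hlow : ∀ κ ∈ splittings m k,
      worstMinCut G k α β ≤ ∑ b, worstMinCut (D b) (κ b) α β := by
    rintro κ ⟨hκ, rfl⟩
    have hex := fun b => (isLeast_worstMinCut (D b) (k := κ b) (by simpa using hκ b) α β).2.1
    choose A hA S hS hSA using hex
    refine (isLeast_worstMinCut G hk α β).2.2
      ⟨_, CutProcess.combine hG hA, (Finset.univ.sigma S).map e.symm.toEmbedding, ?_, ?_⟩
    · simp [hS]
    · intro i hi
      obtain ⟨x, hx, rfl⟩ := Finset.mem_map.1 hi
      simp only [Set.mem_ofPred_eq, Equiv.coe_toEmbedding]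
      rw [Equiv.apply_symm_apply]
      exact hSA x.1 x.2 (Finset.mem_sigma.1 hx).2
  refine ⟨?_, by rintro _ ⟨κ, hκ, rfl⟩; exact hlow κ hκ⟩
  obtain ⟨A, H, S, hS, hSA⟩ := (isLeast_worstMinCut G hk α β).2.1
  obtain ⟨γ, hγ, hsum⟩ := H.exists_split hG
  -- The trace of the accessed set `S` on each group; its sizes are the splitting that attains the
  -- minimum.
  set T : ∀ b, Finset (Fin (m b)) := fun b =>
    Finset.univ.filter fun y => e.symm ⟨b, y⟩ ∈ S with hT
  have hTle : ∀ b, (T b).card ≤ m b := fun b => by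
    simpa using Finset.card_le_univ (T b)
  have hκ : (fun b => (T b).card) ∈ splittings m k := by
    refine ⟨hTle, ?_⟩
    rw [← Finset.card_sigma, ← hS, ← Finset.card_map e.symm.toEmbedding]
    congr 1
    ext i
    obtain ⟨⟨b, y⟩, rfl⟩ := e.symm.surjective i
    simp [hT]
  refine ⟨_, hκ, le_antisymm ?_ (hlow _ hκ)⟩
  rw [← hsum]
  refine Finset.sum_le_sum fun b _ => ?_
  refine (isLeast_worstMinCut (D b) (by simpa using hTle b) α β).2.2
    ⟨_, hγ b, T b, rfl, fun y hy => hSA _ (Finset.mem_filter.1 hy).2⟩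

theorem groupedFamilyScheme_symm_apply {N : Type*} {B : ℕ} (m : Fin B → ℕ) (d : ℕ)
    (e : N ≃ Σ b : Fin B, Fin (m b)) (b : Fin B) (y : Fin (m b)) :
    groupedFamilyScheme m d e (e.symm ⟨b, y⟩) =
      (familyScheme (m b) d y).map
        ((Function.Embedding.sigmaMk b).trans e.symm.toEmbedding) := by
  unfold groupedFamilyScheme
  rw [Equiv.apply_symm_apply]

theorem mainTheorem9 (n k d : ℕ) (hk : 1 ≤ k) (hkn : k < n) (hd : 1 ≤ d) (hdn : d < n)
    (α β : ℝ≥0∞) :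
    -- the family-plus scheme
    (∀ e : Fin n ≃ Σ b : Fin (familyPlusCount n d), Fin (familyPlusSize n d b),
      IsLeast (minCutValues (groupedFamilyScheme (familyPlusSize n d) d e) k α β)
        (worstMinCut (groupedFamilyScheme (familyPlusSize n d) d e) k α β) ∧
      (∀ κ ∈ splittings (familyPlusSize n d) k, ∀ b,
        IsLeast (minCutValues (familyScheme (familyPlusSize n d b) d) (κ b) α β)
          (worstMinCut (familyScheme (familyPlusSize n d b) d) (κ b) α β)) ∧
      IsLeast
        ((fun κ : Fin (familyPlusCount n d) → ℕ =>
          ∑ b, worstMinCut (familyScheme (familyPlusSize n d b) d) (κ b) α β) ''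
            splittings (familyPlusSize n d) k)
        (worstMinCut (groupedFamilyScheme (familyPlusSize n d) d e) k α β)) ∧
    -- the generalized family-plus scheme, with arbitrary group sizes
    (∀ (B : ℕ) (m : Fin B → ℕ) (e : Fin n ≃ Σ b : Fin B, Fin (m b)), (∀ b, d < m b) →
      IsLeast (minCutValues (groupedFamilyScheme m d e) k α β)
        (worstMinCut (groupedFamilyScheme m d e) k α β) ∧
      (∀ κ ∈ splittings m k, ∀ b,
        IsLeast (minCutValues (familyScheme (m b) d) (κ b) α β)
          (worstMinCut (familyScheme (m b) d) (κ b) α β)) ∧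
      IsLeast
        ((fun κ : Fin B → ℕ => ∑ b, worstMinCut (familyScheme (m b) d) (κ b) α β) ''
          splittings m k)
        (worstMinCut (groupedFamilyScheme m d e) k α β)) := by
  -- Both schemes are groupings, so one statement for all group sizes serves for both.
  have main : ∀ (B : ℕ) (m : Fin B → ℕ) (e : Fin n ≃ Σ b : Fin B, Fin (m b)),
      IsLeast (minCutValues (groupedFamilyScheme m d e) k α β)
        (worstMinCut (groupedFamilyScheme m d e) k α β) ∧
      (∀ κ ∈ splittings m k, ∀ b,
        IsLeast (minCutValues (familyScheme (m b) d) (κ b) α β)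
          (worstMinCut (familyScheme (m b) d) (κ b) α β)) ∧
      IsLeast
        ((fun κ : Fin B → ℕ => ∑ b, worstMinCut (familyScheme (m b) d) (κ b) α β) ''
          splittings m k)
        (worstMinCut (groupedFamilyScheme m d e) k α β) := fun B m e =>
    ⟨(isLeast_worstMinCut _ (by simpa using hkn.le) α β).1,
      fun κ hκ b => (isLeast_worstMinCut _ (by simpa using hκ.1 b) α β).1,
      isLeast_worstMinCut_of_grouping _ _ e (groupedFamilyScheme_symm_apply m d e)
        (by simpa using hkn.le) α β⟩
  exact ⟨fun e => main _ _ e, fun B m e _ => main B m e⟩
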